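/- Let $p$ be a prime and let $\mathbb F_p$ be the field with $p$ elements, equipped with the discrete topology. Let $\mathbb V_p^+=\bigoplus_{n\in\mathbb N}\mathbb F_p$ with the discrete topology, let $\mathbb V_p^-=\prod_{n\in\mathbb N}\mathbb F_p$ with the product topology, and let $\mathbb V_p=\mathbb V_p^-\oplus\mathbb V_p^+$ with the product topology of the two summands. Then each of $\mathbb V_p^+$, $\mathbb V_p^-$, $\mathbb V_p$ is an infinite, second-countable, locally compact Hausdorff topological vector space over $\mathbb F_p$; no two of them are isomorphic; and every infinite, second-countable, locally compact Hausdorff topological vector space over $\mathbb F_p$ is isomorphic to one of them (hence to exactly one). Here an isomorphism is an $\mathbb F_p$-linear homeomorphism. -/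

import Mathlib

/-- `V` is an infinite, second-countable, locally compact (Hausdorff) linear space over the field
`𝔽_p = ZMod p`, which carries the discrete topology. -/
structure IsInfiniteLCSpace (p : ℕ) (V : Type*) [AddCommGroup V] [Module (ZMod p) V]
    [TopologicalSpace V] : Prop where
  isTopologicalAddGroup : IsTopologicalAddGroup V
  continuousSMul : ContinuousSMul (ZMod p) V
  t2Space : T2Space V
  locallyCompactSpace : LocallyCompactSpace V
  secondCountableTopology : SecondCountableTopology V
  infinite : Infinite V

/-- `𝕍_p^+`: the direct sum of countably many copies of `𝔽_p`. -/
abbrev VPlus (p : ℕ) : Type := ℕ →₀ ZMod p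

/-- The topology of `𝕍_p^+` is discrete. -/
instance VPlus.instTopologicalSpace (p : ℕ) : TopologicalSpace (VPlus p) := ⊥

/-- `𝕍_p^-`: the direct product of countably many copies of the discrete field `𝔽_p`, with the
product topology. -/
abbrev VMinus (p : ℕ) : Type := ℕ → ZMod p

/-- `𝕍_p = 𝕍_p^- ⊕ 𝕍_p^+`, with the product topology of the two summands. -/
abbrev VSum (p : ℕ) : Type := VMinus p × VPlus p

open Topology


/-! The space `V` splits as a compact open subspace plus a discrete complement. The summands are
classified separately, and discreteness and compactness tell the three models apart. A compact open
subspace is `L + K`, with `K` a symmetric compact neighbourhood of 0 and `L` the finite span of the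
translations needed to cover `K + K` by `K`. A discrete summand is classified by its dimension. A
compact summand is recovered from its continuous dual: a countable basis of functionals embeds it in
`VMinus p`, densely by linear independence, hence onto by compactness. That functionals separate
points requires small open subspaces. They come from Bogolyubov's lemma in finite subspaces: its
index bound depends only on the number of translates of a neighbourhood covering the space, so an
ultralimit over finite subspaces still has finite index. -/

/-! ### Fourier analysis on finite groups and Bogolyubov's lemma -/

/-- The squared modulus of a character sum over `S` is the character sum over the differences of
elements of `S`. -/
theorem AddChar.normSq_sum_eq {A : Type*} [AddCommGroup A] [Finite A] (S : Finset A)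
    (χ : AddChar A ℂ) :
    ((‖∑ a ∈ S, χ a‖ ^ 2 : ℝ) : ℂ) = ∑ t ∈ S ×ˢ S, χ (t.1 - t.2) := by
  push_cast
  rw [← Complex.mul_conj', map_sum, Finset.sum_mul_sum, Finset.sum_product]
  refine Finset.sum_congr rfl fun a _ => Finset.sum_congr rfl fun b _ => ?_
  rw [sub_eq_add_neg, AddChar.map_add_eq_mul, AddChar.map_neg_eq_conj]

/-- Parseval's identity for the indicator function of `S`. -/
theorem AddChar.sum_normSq_sum {A : Type*} [AddCommGroup A] [Fintype A] (S : Finset A) :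
    ∑ χ : AddChar A ℂ, ‖∑ a ∈ S, χ a‖ ^ 2 = (Fintype.card A : ℝ) * S.card := by
  classical
  have h : ((∑ χ : AddChar A ℂ, ‖∑ a ∈ S, χ a‖ ^ 2 : ℝ) : ℂ) = (Fintype.card A : ℂ) * S.card := by
    rw [Complex.ofReal_sum]
    simp_rw [AddChar.normSq_sum_eq]
    rw [Finset.sum_comm]
    simp_rw [AddChar.sum_apply_eq_ite, sub_eq_zero]
    rw [Finset.sum_product]
    simp [mul_comm]
  exact_mod_cast h

/-- Expanding the fourth power gives sums of `χ` at fixed nonzero points, which vanish by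
orthogonality. -/
theorem AddChar.sum_normSq_sum_sq_mul_eq_zero {A : Type*} [AddCommGroup A] [Fintype A]
    (S : Finset A) (x : A)
    (hx : ∀ a ∈ S, ∀ b ∈ S, ∀ c ∈ S, ∀ d ∈ S, x ≠ (a - b) + (c - d)) :
    ∑ χ : AddChar A ℂ, (‖∑ a ∈ S, χ a‖ ^ 2) ^ 2 * (χ x).re = 0 := by
  classical
  have h : ∑ χ : AddChar A ℂ, (((‖∑ a ∈ S, χ a‖ ^ 2 : ℝ) : ℂ)) ^ 2 * χ x = 0 := by
    simp_rw [AddChar.normSq_sum_eq, sq, Finset.sum_mul_sum, Finset.sum_mul,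
      ← AddChar.map_add_eq_mul]
    rw [Finset.sum_comm]
    refine Finset.sum_eq_zero fun t ht => ?_
    rw [Finset.sum_comm]
    refine Finset.sum_eq_zero fun u hu => ?_
    rw [AddChar.sum_apply_eq_zero_iff_ne_zero]
    intro h0
    simp only [Finset.mem_product] at ht hu
    refine hx t.2 ht.2 t.1 ht.1 u.2 hu.2 u.1 hu.1 ?_
    rw [eq_comm, ← sub_eq_zero, ← neg_eq_zero, ← h0]
    abel
  have h2 := congrArg Complex.re h
  rw [Complex.re_sum] at h2
  simpa only [← Complex.ofReal_pow, Complex.re_ofReal_mul, Complex.zero_re] using h2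

/-- The common kernel of a set of characters. -/
def AddChar.commonKer {A : Type*} [AddCommGroup A] (T : Set (AddChar A ℂ)) : AddSubgroup A where
  carrier := {x | ∀ χ ∈ T, χ x = 1}
  zero_mem' := fun χ _ => χ.map_zero_eq_one
  add_mem' := fun {a b} ha hb χ h => by rw [AddChar.map_add_eq_mul, ha χ h, hb χ h, one_mul]
  neg_mem' := fun {a} ha χ h => by rw [AddChar.map_neg_eq_inv, ha χ h, inv_one]

/-- In a group of exponent `p`, more than `p ^ #T` elements contain two that are congruent modulo
the common kernel of `T`. -/
theorem AddChar.exists_sub_mem_commonKer {p : ℕ} [NeZero p] {A : Type*} [AddCommGroup A]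
    (hp : ∀ a : A, p • a = 0) (T : Finset (AddChar A ℂ)) {N : ℕ} (hN : p ^ T.card < N)
    (f : Fin N → A) :
    ∃ i j, i ≠ j ∧ f i - f j ∈ AddChar.commonKer (T : Set (AddChar A ℂ)) := by
  classical
  -- Exponent `p` forces characters to take values in the `p`-th roots of unity.
  let R := Polynomial.nthRootsFinset p (1 : ℂ)
  have hR : R.card ≤ p := by
    simp only [R, Polynomial.nthRootsFinset_def]
    exact (Multiset.toFinset_card_le _).trans (Polynomial.card_nthRoots p 1)
  have hmem : ∀ (χ : AddChar A ℂ) (a : A), χ a ∈ R := by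
    intro χ a
    rw [Polynomial.mem_nthRootsFinset (NeZero.pos p), ← AddChar.map_nsmul_eq_pow, hp,
      AddChar.map_zero_eq_one]
  let g : Fin N → (T → R) := fun i χ => ⟨χ.1 (f i), hmem _ _⟩
  have hcard : Fintype.card (T → R) < Fintype.card (Fin N) := by
    rw [Fintype.card_fun, Fintype.card_coe, Fintype.card_coe, Fintype.card_fin]
    exact (Nat.pow_le_pow_left hR _).trans_lt hN
  obtain ⟨i, j, hij, h⟩ := Fintype.exists_ne_map_eq_of_card_lt g hcard
  refine ⟨i, j, hij, fun χ hχ => ?_⟩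
  have := congrArg Subtype.val (congrFun h ⟨χ, hχ⟩)
  simp only [g] at this
  rw [AddChar.map_sub_eq_div, this, div_self (AddChar.val_isUnit χ _).ne_zero]

/-- **Bogolyubov's lemma** in finite groups of exponent `p`: a set of density at least `1 / m`
has a fourfold sum-difference set that contains a subgroup of index at most `p ^ m ^ 2`. -/
theorem exists_addSubgroup_subset_sub_add_sub {p : ℕ} [NeZero p] {A : Type*} [AddCommGroup A]
    [Fintype A] (hp : ∀ a : A, p • a = 0) (S : Finset A) (m : ℕ)
    (hS : Fintype.card A ≤ m * S.card) :
    ∃ B : AddSubgroup A,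
      (∀ x ∈ B, ∃ a ∈ S, ∃ b ∈ S, ∃ c ∈ S, ∃ d ∈ S, x = (a - b) + (c - d)) ∧
      ∀ f : Fin (p ^ m ^ 2 + 1) → A, ∃ i j, i ≠ j ∧ f i - f j ∈ B := by
  classical
  set q : AddChar A ℂ → ℝ := fun χ => ‖∑ a ∈ S, χ a‖ ^ 2 with hq
  have hq0 : ∀ χ, 0 ≤ q χ := fun χ => sq_nonneg _
  have hAS : (Fintype.card A : ℝ) ≤ m * S.card := by exact_mod_cast hS
  have hA : 0 < Fintype.card A := Fintype.card_pos
  have hSpos : (0 : ℝ) < S.card := by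
    have : 0 < m * S.card := hA.trans_le hS
    exact_mod_cast Nat.pos_of_mul_pos_left this
  have hpars : ∑ χ, q χ = (Fintype.card A : ℝ) * S.card := AddChar.sum_normSq_sum S
  -- The large spectrum of `S`; Parseval and the density of `S` bound its size by `m ^ 2`.
  set T : Finset (AddChar A ℂ) := {χ | (S.card : ℝ) ^ 2 ≤ m * q χ} with hT
  have hTcard : T.card ≤ m ^ 2 := by
    have h1 : (T.card : ℝ) * (S.card : ℝ) ^ 2 ≤ (m : ℝ) ^ 2 * (S.card : ℝ) ^ 2 := by
      calc (T.card : ℝ) * (S.card : ℝ) ^ 2 = ∑ χ ∈ T, (S.card : ℝ) ^ 2 := by simp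
        _ ≤ ∑ χ ∈ T, m * q χ := Finset.sum_le_sum fun χ h => (Finset.mem_filter.1 h).2
        _ ≤ ∑ χ, m * q χ := Finset.sum_le_sum_of_subset_of_nonneg (Finset.subset_univ _)
            fun χ _ _ => mul_nonneg (Nat.cast_nonneg _) (hq0 χ)
        _ = m * ((Fintype.card A : ℝ) * S.card) := by rw [← Finset.mul_sum, hpars]
        _ ≤ m * ((m * S.card) * S.card) := by gcongr
        _ = (m : ℝ) ^ 2 * (S.card : ℝ) ^ 2 := by ring
    exact_mod_cast le_of_mul_le_mul_right h1 (by positivity)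
  refine ⟨AddChar.commonKer (T : Set (AddChar A ℂ)), fun x hx => ?_,
    AddChar.exists_sub_mem_commonKer hp T (Nat.lt_succ_of_le
      (Nat.pow_le_pow_right (NeZero.pos p) hTcard))⟩
  by_contra! hcon
  have h0 : ∑ χ, q χ ^ 2 * (χ x).re = 0 := AddChar.sum_normSq_sum_sq_mul_eq_zero S x hcon
  -- With `s = #S`, the trivial character contributes `m * s ^ 4`, and by this bound the others at
  -- least `-s ^ 2 * (#A * s - s ^ 2)`. As `#A ≤ m * s`, the total is at least `s ^ 4 > 0`,
  -- contradicting `h0`.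
  have hterm : ∀ χ, -((S.card : ℝ) ^ 2 * q χ) ≤ m * (q χ ^ 2 * (χ x).re) := by
    intro χ
    by_cases h : χ ∈ T
    · rw [hx χ h, Complex.one_re, mul_one]
      have : 0 ≤ (S.card : ℝ) ^ 2 * q χ := mul_nonneg (sq_nonneg _) (hq0 χ)
      have : 0 ≤ (m : ℝ) * q χ ^ 2 := by positivity
      linarith
    · have h1 : m * q χ ≤ (S.card : ℝ) ^ 2 := by
        simp only [hT, Finset.mem_filter, Finset.mem_univ, true_and, not_le] at h
        exact h.le
      have h2 : -1 ≤ (χ x).re := by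
        have := Complex.abs_re_le_norm (χ x)
        rw [AddChar.norm_apply] at this
        exact (abs_le.1 this).1
      have h3 : m * q χ * q χ ≤ (S.card : ℝ) ^ 2 * q χ := mul_le_mul_of_nonneg_right h1 (hq0 χ)
      have h4 : (m * q χ ^ 2) * (-1) ≤ (m * q χ ^ 2) * (χ x).re :=
        mul_le_mul_of_nonneg_left h2 (by positivity)
      linarith
  have hq1 : q 0 = (S.card : ℝ) ^ 2 := by simp [hq]
  have h1 : ∑ χ ∈ Finset.univ.erase (0 : AddChar A ℂ), -((S.card : ℝ) ^ 2 * q χ) ≤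
      ∑ χ ∈ Finset.univ.erase (0 : AddChar A ℂ), m * (q χ ^ 2 * (χ x).re) :=
    Finset.sum_le_sum fun χ _ => hterm χ
  have h2 := Finset.add_sum_erase Finset.univ (fun χ => m * (q χ ^ 2 * (χ x).re))
    (Finset.mem_univ 0)
  have h3 := Finset.add_sum_erase Finset.univ q (Finset.mem_univ 0)
  rw [← Finset.mul_sum, ← Finset.mul_sum, h0] at h2
  rw [Finset.sum_neg_distrib, ← Finset.mul_sum] at h1
  rw [hpars] at h3
  simp only [AddChar.zero_apply, Complex.one_re, mul_one, hq1, mul_zero] at h2 h3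
  set s : ℝ := (S.card : ℝ)
  have h5 : (∑ χ ∈ Finset.univ.erase (0 : AddChar A ℂ), q χ) = Fintype.card A * s - s ^ 2 := by
    linarith
  rw [h5, ← Finset.mul_sum] at h1
  have h6 : Fintype.card A * s ^ 3 ≤ m * s * s ^ 3 := by gcongr
  have h7 : 0 < s ^ 4 := by positivity
  linarith

/-! ### From finite subspaces to the whole space -/

/-- The subspace spanned by a finite set over a finite field is finite. -/
theorem ZMod.finite_span {p : ℕ} [NeZero p] {V : Type*} [AddCommGroup V] [Module (ZMod p) V]
    (t : Finset V) : Finite (Submodule.span (ZMod p) (t : Set V)) :=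
  have : Module.Finite (ZMod p) (Submodule.span (ZMod p) (t : Set V)) :=
    Module.Finite.span_of_finite _ t.finite_toSet
  Module.finite_of_finite (ZMod p)

/-- A subgroup of finite index is detected by a pigeonhole property. -/
theorem AddSubgroup.finiteIndex_of_pigeonhole {V : Type*} [AddCommGroup V] (B : AddSubgroup V)
    (N : ℕ) (h : ∀ f : Fin N → V, ∃ i j, i ≠ j ∧ f i - f j ∈ B) : B.FiniteIndex := by
  have : Finite (V ⧸ B) := by
    by_contra hinf
    rw [not_finite_iff_infinite] at hinf
    let e := Infinite.natEmbedding (V ⧸ B)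
    obtain ⟨i, j, hij, hB⟩ := h fun i => (e i).out
    apply hij
    have h1 : ((e j).out : V ⧸ B) = ((e i).out : V ⧸ B) := by
      rw [QuotientAddGroup.eq, neg_add_eq_sub]
      exact hB
    rw [QuotientAddGroup.out_eq', QuotientAddGroup.out_eq'] at h1
    exact Fin.val_injective (e.injective h1.symm)
  exact AddSubgroup.finiteIndex_of_finite_quotient

/-- **Bogolyubov's lemma** relative to a finite subgroup `A` of a group covered by `m` translates
of `K`. -/
theorem exists_addSubgroup_of_translates_cover {p : ℕ} [NeZero p] {V : Type*} [AddCommGroup V]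
    [Module (ZMod p) V] (F : Finset V) (K : Set V) (hFK : ∀ v, ∃ f ∈ F, v - f ∈ K)
    (A : Submodule (ZMod p) V) [Finite A] :
    ∃ B : AddSubgroup V, B ≤ A.toAddSubgroup ∧
      (∀ x ∈ B, ∃ a ∈ K, ∃ b ∈ K, ∃ c ∈ K, ∃ d ∈ K, x = (a - b) + (c - d)) ∧
      ∀ f : Fin (p ^ F.card ^ 2 + 1) → V, (∀ i, f i ∈ A) → ∃ i j, i ≠ j ∧ f i - f j ∈ B := by
  classical
  cases nonempty_fintype A
  choose c hcF hcK using hFK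
  have hFne : F.Nonempty := ⟨c 0, hcF 0⟩
  -- The most popular translate meets `A` in density at least `1 / #F`; the shift by `y` cancels in
  -- differences.
  obtain ⟨y, -, hymax⟩ := Finset.exists_max_image F
    (fun y => (Finset.univ.filter fun a : A => c a = y).card) hFne
  set S : Finset A := Finset.univ.filter fun a : A => c a = y with hS
  have hcard : Fintype.card A ≤ F.card * S.card := by
    calc Fintype.card A = ∑ z ∈ F, (Finset.univ.filter fun a : A => c a = z).card :=
          Finset.card_eq_sum_card_fiberwise fun a _ => hcF a
      _ ≤ ∑ z ∈ F, S.card := Finset.sum_le_sum hymax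
      _ = F.card * S.card := by simp
  have hp : ∀ a : A, p • a = 0 := fun a => by
    rw [← Nat.cast_smul_eq_nsmul (ZMod p), ZMod.natCast_self, zero_smul]
  obtain ⟨B, hB, hidx⟩ := exists_addSubgroup_subset_sub_add_sub hp S F.card hcard
  refine ⟨B.map A.toAddSubgroup.subtype, ?_, ?_, ?_⟩
  · rintro x ⟨b, -, rfl⟩
    exact b.2
  · rintro x ⟨b, hb, rfl⟩
    obtain ⟨a₁, h₁, a₂, h₂, a₃, h₃, a₄, h₄, rfl⟩ := hB b hb
    have key : ∀ a ∈ S, (a : V) - y ∈ K := fun a ha => by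
      rw [← (Finset.mem_filter.1 ha).2]
      exact hcK a
    refine ⟨_, key a₁ h₁, _, key a₂ h₂, _, key a₃ h₃, _, key a₄ h₄, ?_⟩
    simp
  · intro f hf
    obtain ⟨i, j, hij, h⟩ := hidx fun i => ⟨f i, hf i⟩
    exact ⟨i, j, hij, _, h, rfl⟩

/-- In a vector space over `𝔽_p` covered by finitely many translates of `K`, the set
`K - K + K - K` contains a subgroup of finite index. -/
theorem exists_finiteIndex_subset_of_translates_cover {p : ℕ} [NeZero p] {V : Type*}
    [AddCommGroup V] [Module (ZMod p) V] (F : Finset V) (K : Set V)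
    (hFK : ∀ v, ∃ f ∈ F, v - f ∈ K) :
    ∃ B : AddSubgroup V, B.FiniteIndex ∧
      ∀ x ∈ B, ∃ a ∈ K, ∃ b ∈ K, ∃ c ∈ K, ∃ d ∈ K, x = (a - b) + (c - d) := by
  classical
  have hfin : ∀ E : Finset V, Finite (Submodule.span (ZMod p) (E : Set V)) := ZMod.finite_span
  choose B hBA hBK hBidx using fun E : Finset V =>
    haveI := hfin E
    exists_addSubgroup_of_translates_cover F K hFK (Submodule.span (ZMod p) (E : Set V))
  -- The pair found by pigeonhole varies with `E`; an ultrafilter selects one of the finitely many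
  -- pairs that works for almost all `E`.
  let 𝒰 : Ultrafilter (Finset V) := Ultrafilter.of Filter.atTop
  have h𝒰 : (𝒰 : Filter (Finset V)) ≤ Filter.atTop := Ultrafilter.of_le _
  let L : AddSubgroup V :=
    { carrier := {x | ∀ᶠ E in (𝒰 : Filter (Finset V)), x ∈ B E}
      zero_mem' := Filter.Eventually.of_forall fun E => (B E).zero_mem
      add_mem' := fun ha hb => by
        filter_upwards [ha, hb] with E h1 h2 using (B E).add_mem h1 h2
      neg_mem' := fun ha => by
        filter_upwards [ha] with E h1 using (B E).neg_mem h1 }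
  refine ⟨L, L.finiteIndex_of_pigeonhole (p ^ F.card ^ 2 + 1) fun f => ?_, fun x hx => ?_⟩
  · have hev : ∀ᶠ E in (𝒰 : Filter (Finset V)),
        ∃ t : Fin (p ^ F.card ^ 2 + 1) × Fin (p ^ F.card ^ 2 + 1),
          t.1 ≠ t.2 ∧ f t.1 - f t.2 ∈ B E := by
      filter_upwards [h𝒰 (Filter.eventually_ge_atTop (Finset.univ.image f))] with E hE
      obtain ⟨i, j, h⟩ := hBidx E f fun i => Submodule.subset_span
        (hE (Finset.mem_image_of_mem f (Finset.mem_univ i)))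
      exact ⟨(i, j), h⟩
    rw [Ultrafilter.eventually_exists_iff] at hev
    obtain ⟨⟨i, j⟩, hij⟩ := hev
    exact ⟨i, j, hij.exists.choose_spec.1, hij.mono fun E h => h.2⟩
  · obtain ⟨E, hE⟩ := Filter.Eventually.exists (f := (𝒰 : Filter (Finset V))) hx
    exact hBK E x hE

/-! ### Open subspaces and complements -/

/-- A compact topological vector space over `𝔽_p` has a neighbourhood basis of open subspaces. -/
theorem exists_isOpen_submodule_subset_of_compactSpace {p : ℕ} [NeZero p] {V : Type*}
    [AddCommGroup V] [Module (ZMod p) V] [TopologicalSpace V] [IsTopologicalAddGroup V]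
    [CompactSpace V] {U : Set V} (hU : U ∈ 𝓝 (0 : V)) :
    ∃ W : Submodule (ZMod p) V, IsOpen (W : Set V) ∧ (W : Set V) ⊆ U := by
  obtain ⟨U', hU', hU'c, hU'U⟩ := exists_mem_nhds_isClosed_subset hU
  obtain ⟨K, hK, hKU⟩ := exists_nhds_zero_quarter hU'
  have hcont : Filter.Tendsto (fun v : V => -v) (𝓝 0) (𝓝 0) := by
    simpa using (continuous_neg (G := V)).tendsto 0
  -- Symmetrizing turns `a - b + (c - d)` into a sum of four elements of `K`.
  set K' : Set V := K ∩ (fun v => -v) ⁻¹' K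
  have hK' : K' ∈ 𝓝 (0 : V) := Filter.inter_mem hK (hcont hK)
  obtain ⟨t, ht⟩ := compact_covered_by_add_left_translates (isCompact_univ (X := V))
    (V := K') ⟨0, mem_interior_iff_mem_nhds.2 hK'⟩
  classical
  obtain ⟨B, hBfin, hB⟩ := exists_finiteIndex_subset_of_translates_cover (p := p)
    (t.image fun v => -v) K' fun v => by
      obtain ⟨g, hg, hv⟩ := Set.mem_iUnion₂.1 (ht (Set.mem_univ v))
      refine ⟨-g, Finset.mem_image_of_mem _ hg, ?_⟩
      rw [sub_neg_eq_add, add_comm]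
      exact hv
  have hBU : (B : Set V) ⊆ U' := fun x hx => by
    obtain ⟨a, ha, b, hb, c, hc, d, hd, rfl⟩ := hB x hx
    rw [sub_eq_add_neg, sub_eq_add_neg, ← add_assoc]
    exact hKU ha.1 hb.2 hc.1 hd.2
  -- `B` itself need not be closed; its closure stays in the closed set `U'` and is open, being
  -- closed of finite index.
  have : B.topologicalClosure.FiniteIndex :=
    AddSubgroup.finiteIndex_of_le B.le_topologicalClosure
  refine ⟨AddSubgroup.toZModSubmodule p B.topologicalClosure, ?_, ?_⟩
  · exact B.topologicalClosure.isOpen_of_isClosed_of_finiteIndex B.isClosed_topologicalClosure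
  · exact (closure_minimal hBU hU'c).trans hU'U

/-- A locally compact topological vector space over `𝔽_p` has a compact open subspace. -/
theorem exists_isOpen_isCompact_submodule {p : ℕ} [NeZero p] {V : Type*}
    [AddCommGroup V] [Module (ZMod p) V] [TopologicalSpace V] [IsTopologicalAddGroup V]
    [LocallyCompactSpace V] :
    ∃ W : Submodule (ZMod p) V, IsOpen (W : Set V) ∧ IsCompact (W : Set V) := by
  obtain ⟨K₀, hK₀, hK₀n⟩ := exists_compact_mem_nhds (0 : V)
  set K : Set V := K₀ ∪ -K₀
  have hK : IsCompact K := hK₀.union hK₀.neg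
  have hKn : K ∈ 𝓝 (0 : V) := Filter.mem_of_superset hK₀n Set.subset_union_left
  have hKneg : ∀ k ∈ K, -k ∈ K := by
    rintro k (h | h)
    · exact Or.inr (by simpa using h)
    · exact Or.inl h
  open Pointwise in
  obtain ⟨t, ht⟩ := compact_covered_by_add_left_translates (hK.add hK)
    (V := K) ⟨0, mem_interior_iff_mem_nhds.2 hKn⟩
  let L := Submodule.span (ZMod p) (t : Set V)
  have : Finite L := ZMod.finite_span t
  let H : AddSubgroup V :=
    { carrier := {x | ∃ l ∈ L, ∃ k ∈ K, l + k = x}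
      zero_mem' := ⟨0, L.zero_mem, 0, mem_of_mem_nhds hKn, add_zero 0⟩
      add_mem' := by
        rintro _ _ ⟨l, hl, k, hk, rfl⟩ ⟨l', hl', k', hk', rfl⟩
        obtain ⟨g, hg, hgk⟩ := Set.mem_iUnion₂.1 (ht (Set.add_mem_add hk hk'))
        refine ⟨l + l' - g, L.sub_mem (L.add_mem hl hl') (Submodule.subset_span hg),
          g + (k + k'), hgk, ?_⟩
        abel
      neg_mem' := by
        rintro _ ⟨l, hl, k, hk, rfl⟩
        exact ⟨-l, L.neg_mem hl, -k, hKneg k hk, by abel⟩ }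
  have hHK : (H : Set V) = (fun q : V × V => q.1 + q.2) '' ((L : Set V) ×ˢ K) := by
    ext x
    constructor
    · rintro ⟨l, hl, k, hk, rfl⟩
      exact ⟨(l, k), ⟨hl, hk⟩, rfl⟩
    · rintro ⟨⟨l, k⟩, ⟨hl, hk⟩, rfl⟩
      exact ⟨l, hl, k, hk, rfl⟩
  refine ⟨AddSubgroup.toZModSubmodule p H, ?_, ?_⟩
  · refine H.isOpen_of_mem_nhds (g := 0) (Filter.mem_of_superset hKn fun k hk => ?_)
    exact ⟨0, L.zero_mem, k, hk, zero_add k⟩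
  · change IsCompact (H : Set V)
    rw [hHK]
    exact ((Set.toFinite (L : Set V)).isCompact.prod hK).image continuous_add

/-- A linear map that is continuous on an open subspace is continuous. -/
theorem Submodule.closedComplemented_of_isOpen {K V : Type*} [Field K] [AddCommGroup V]
    [Module K V] [TopologicalSpace V] [IsTopologicalAddGroup V] {W : Submodule K V}
    (hW : IsOpen (W : Set V)) : W.ClosedComplemented := by
  -- Any algebraic projection onto `W` works: near 0 it is the identity.
  obtain ⟨f, hf⟩ := W.subtype.exists_leftInverse_of_injective W.ker_subtype
  have hfx : ∀ x : W, f x = x := fun x => LinearMap.congr_fun hf x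
  have hcont : Continuous f := by
    refine continuous_of_continuousAt_zero f ?_
    have h := (hW.isOpenEmbedding_subtypeVal.continuousAt_iff (g := f) (x := (0 : W))).1 (by
      exact continuousAt_id.congr (Filter.Eventually.of_forall fun x => (hfx x).symm))
    exact h
  exact ⟨⟨f, hcont⟩, hfx⟩

/-! ### Discrete spaces -/

/-- A countably infinite discrete vector space over `𝔽_p` is isomorphic to `𝕍_p^+`. -/
theorem nonempty_equiv_vPlus {p : ℕ} [Fact p.Prime] {V : Type*}
    [AddCommGroup V] [Module (ZMod p) V] [TopologicalSpace V] [DiscreteTopology V]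
    [Countable V] [Infinite V] : Nonempty (V ≃L[ZMod p] VPlus p) := by
  let b := Module.Basis.ofVectorSpace (ZMod p) V
  set J := Module.Basis.ofVectorSpaceIndex (ZMod p) V
  have : Infinite J := by
    by_contra hfin
    rw [not_infinite_iff_finite] at hfin
    have : Module.Finite (ZMod p) V := Module.Finite.of_basis b
    have : Finite V := Module.finite_of_finite (ZMod p)
    exact not_finite V
  obtain ⟨e⟩ := nonempty_equiv_of_countable (α := J) (β := ℕ)
  have : DiscreteTopology (VPlus p) := ⟨rfl⟩
  exact ⟨{ (b.reindex e).repr with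
    continuous_toFun := continuous_of_discreteTopology
    continuous_invFun := continuous_of_discreteTopology }⟩

/-! ### Compact spaces and their continuous duals -/

section Compact

variable {p : ℕ} [Fact p.Prime] {V : Type*} [AddCommGroup V] [Module (ZMod p) V]
  [TopologicalSpace V] [IsTopologicalAddGroup V] [CompactSpace V] [T2Space V]

/-- Continuous linear functionals separate the points of a compact space over `𝔽_p`. -/
theorem exists_continuousLinearMap_apply_ne_zero {x : V} (hx : x ≠ 0) :
    ∃ φ : V →L[ZMod p] ZMod p, φ x ≠ 0 := by
  obtain ⟨W, hW, hWx⟩ := exists_isOpen_submodule_subset_of_compactSpace (p := p)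
    (isOpen_compl_singleton.mem_nhds hx.symm : ({x}ᶜ : Set V) ∈ 𝓝 0)
  obtain ⟨f, hfx, hWf⟩ := Submodule.exists_le_ker_of_notMem fun h : x ∈ W => hWx h rfl
  refine ⟨⟨f, continuous_of_continuousAt_zero f ?_⟩, hfx⟩
  rw [ContinuousAt, map_zero, nhds_discrete (ZMod p), Filter.tendsto_pure]
  filter_upwards [hW.mem_nhds W.zero_mem] with y hy using hWf hy

/-- A continuous functional is constant on a preconnected set, its target being discrete, while
functionals separate points. -/
theorem totallyDisconnectedSpace_of_compactSpace (p : ℕ) [Fact p.Prime] {V : Type*}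
    [AddCommGroup V] [Module (ZMod p) V] [TopologicalSpace V] [IsTopologicalAddGroup V]
    [CompactSpace V] [T2Space V] : TotallyDisconnectedSpace V := by
  refine ⟨fun s _ hs x hx y hy => ?_⟩
  by_contra hxy
  obtain ⟨φ, hφ⟩ := exists_continuousLinearMap_apply_ne_zero (p := p) (sub_ne_zero.2 hxy)
  apply hφ
  rw [map_sub, sub_eq_zero]
  exact (hs.image φ φ.continuous.continuousOn).subsingleton
    (Set.mem_image_of_mem φ hx) (Set.mem_image_of_mem φ hy)

/-- The continuous dual of a second-countable compact space over `𝔽_p` is countable. -/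
theorem countable_continuousDual [SecondCountableTopology V] :
    Countable (V →L[ZMod p] ZMod p) := by
  have := totallyDisconnectedSpace_of_compactSpace p (V := V)
  have : Countable (TopologicalSpace.Clopens V) :=
    TopologicalSpace.Clopens.countable_iff_secondCountable.2 inferInstance
  -- A functional is determined by its clopen fibres, and there are only countably many clopen sets.
  let g : (V →L[ZMod p] ZMod p) → (ZMod p → TopologicalSpace.Clopens V) := fun φ a =>
    ⟨φ ⁻¹' {a}, (isClopen_discrete _).preimage φ.continuous⟩
  refine Function.Injective.countable (f := g) fun φ ψ h => ?_
  ext x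
  have h1 : x ∈ g φ (φ x) := rfl
  rw [h] at h1
  exact h1.symm

/-- Linearly independent functionals take prescribed values on finite sets of indices. -/
theorem LinearIndependent.exists_apply_eq {K V ι : Type*} [Field K] [AddCommGroup V] [Module K V]
    {b : ι → V →ₗ[K] K} (hb : LinearIndependent K b) (E : Finset ι) (y : ι → K) :
    ∃ x, ∀ i ∈ E, b i x = y i := by
  let Φ : V →ₗ[K] (E → K) := LinearMap.pi fun i => b i
  -- A nonzero functional vanishing on the range would be a linear relation among the `b i`.
  have hΦ : LinearMap.range Φ = ⊤ := by
    by_contra hne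
    obtain ⟨f, hf, hker⟩ := Submodule.exists_le_ker_of_lt_top _ (lt_top_iff_ne_top.2 hne)
    classical
    have hfΦ : ∑ i : E, f (Pi.single i 1) • b i = 0 := by
      ext x
      have h0 : f (Φ x) = 0 := hker ⟨x, rfl⟩
      have hs : ∀ i : E, (fun j => if i = j then (1 : K) else 0) = Pi.single i 1 := fun i => by
        ext j
        simp [Pi.single_apply, eq_comm]
      rw [LinearMap.pi_apply_eq_sum_univ] at h0
      simpa [Φ, mul_comm, hs] using h0
    have hli := hb.comp (Subtype.val : E → ι) Subtype.val_injective
    have hz := Fintype.linearIndependent_iff.1 hli _ hfΦ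
    apply hf
    refine LinearMap.pi_ext' fun i => LinearMap.ext_ring ?_
    simpa using hz i
  obtain ⟨x, hx⟩ := LinearMap.range_eq_top.1 hΦ fun i => y i
  exact ⟨x, fun i hi => congrFun hx ⟨i, hi⟩⟩

/-- An infinite second-countable compact space over `𝔽_p` is isomorphic to `𝕍_p^-`. -/
theorem nonempty_equiv_vMinus [SecondCountableTopology V] [Infinite V] :
    Nonempty (V ≃L[ZMod p] VMinus p) := by
  let b := Module.Basis.ofVectorSpace (ZMod p) (V →L[ZMod p] ZMod p)
  set I := Module.Basis.ofVectorSpaceIndex (ZMod p) (V →L[ZMod p] ZMod p)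
  have : Countable (V →L[ZMod p] ZMod p) := countable_continuousDual
  have hinj : ∀ x : V, (∀ i, b i x = 0) → x = 0 := by
    intro x hx
    by_contra hne
    obtain ⟨φ, hφ⟩ := exists_continuousLinearMap_apply_ne_zero (p := p) hne
    apply hφ
    have h : ∀ φ ∈ Submodule.span (ZMod p) (Set.range b), φ x = 0 := by
      intro φ hφ
      induction hφ using Submodule.span_induction with
      | mem ψ h => obtain ⟨i, rfl⟩ := h; exact hx i
      | zero => rfl
      | add ψ χ _ _ h1 h2 => rw [add_apply, h1, h2, add_zero]
      | smul a ψ _ h1 => rw [smul_apply, h1, smul_zero]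
    exact h φ (b.span_eq ▸ Submodule.mem_top)
  have : Infinite I := by
    by_contra hfin
    rw [not_infinite_iff_finite] at hfin
    refine not_finite_iff_infinite.2 ‹Infinite V› (Finite.of_injective
      (fun (x : V) (i : I) => b i x) fun x y hxy => ?_)
    rw [← sub_eq_zero]
    refine hinj _ fun i => ?_
    rw [map_sub, sub_eq_zero]
    exact congrFun hxy i
  obtain ⟨e⟩ := nonempty_equiv_of_countable (α := I) (β := ℕ)
  let c := b.reindex e
  let Φ : V →L[ZMod p] VMinus p := ContinuousLinearMap.pi fun n => c n
  have hΦinj : Function.Injective Φ := by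
    rw [injective_iff_map_eq_zero]
    intro x hx
    refine hinj x fun i => ?_
    have h := congrFun hx (e i)
    simpa [Φ, c] using h
  have hΦsurj : Function.Surjective Φ := by
    have hclosed : IsClosed (Set.range Φ) := (isCompact_range Φ.continuous).isClosed
    -- The range is closed, so density suffices; a basic open set constrains only finitely many
    -- coordinates.
    rw [← Set.range_eq_univ, ← hclosed.closure_eq, Set.eq_univ_iff_forall]
    intro y
    rw [mem_closure_iff]
    intro o ho hy
    obtain ⟨E, u, hu, huo⟩ := isOpen_pi_iff.1 ho y hy
    have hli : LinearIndependent (ZMod p) fun n => (c n : V →ₗ[ZMod p] ZMod p) :=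
      c.linearIndependent.map' (ContinuousLinearMap.coeLM (ZMod p))
        (LinearMap.ker_eq_bot.2 ContinuousLinearMap.coe_injective)
    obtain ⟨x, hx⟩ := hli.exists_apply_eq E y
    refine ⟨Φ x, huo fun i hi => ?_, x, rfl⟩
    have : Φ x i = y i := hx i hi
    rw [this]
    exact (hu i hi).2
  let ε : V ≃ₗ[ZMod p] VMinus p :=
    LinearEquiv.ofBijective (Φ : V →ₗ[ZMod p] VMinus p) ⟨hΦinj, hΦsurj⟩
  have hε : Continuous ε.toEquiv := Φ.continuous
  exact ⟨{ ε with
    continuous_toFun := hε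
    continuous_invFun := (hε.homeoOfEquivCompactToT2 (f := ε.toEquiv)).symm.continuous }⟩

end Compact

/-! ### Topological invariants of the three models -/

theorem vPlus_discreteTopology (p : ℕ) : DiscreteTopology (VPlus p) := ⟨rfl⟩

theorem vMinus_not_discreteTopology (p : ℕ) [Fact p.Prime] : ¬ DiscreteTopology (VMinus p) :=
  fun _ => not_finite_iff_infinite.2 (inferInstance : Infinite (VMinus p)) finite_of_compact_of_discrete

theorem vPlus_not_compactSpace (p : ℕ) [Fact p.Prime] : ¬ CompactSpace (VPlus p) := fun _ =>
  have := vPlus_discreteTopology p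
  not_finite_iff_infinite.2 (inferInstance : Infinite (VPlus p)) finite_of_compact_of_discrete

theorem vSum_not_discreteTopology (p : ℕ) [Fact p.Prime] : ¬ DiscreteTopology (VSum p) := fun _ =>
  vMinus_not_discreteTopology p
    (DiscreteTopology.of_continuous_injective (f := fun x : VMinus p => ((x, 0) : VSum p))
      (by fun_prop) fun _ _ h => congrArg Prod.fst h)

theorem vSum_not_compactSpace (p : ℕ) [Fact p.Prime] : ¬ CompactSpace (VSum p) := fun _ =>
  vPlus_not_compactSpace p (Function.Surjective.compactSpace (f := (Prod.snd : VSum p → VPlus p))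
    continuous_snd Prod.snd_surjective)

theorem vPlus_isInfiniteLCSpace (p : ℕ) [Fact p.Prime] : IsInfiniteLCSpace p (VPlus p) := by
  have := vPlus_discreteTopology p
  exact ⟨⟨⟩, ⟨continuous_of_discreteTopology⟩, inferInstance, inferInstance,
    inferInstance, inferInstance⟩

theorem vMinus_isInfiniteLCSpace (p : ℕ) [Fact p.Prime] : IsInfiniteLCSpace p (VMinus p) :=
  ⟨inferInstance, inferInstance, inferInstance, inferInstance, inferInstance, inferInstance⟩

theorem vSum_isInfiniteLCSpace (p : ℕ) [Fact p.Prime] : IsInfiniteLCSpace p (VSum p) := by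
  obtain ⟨_, _, _, _, _, _⟩ := vPlus_isInfiniteLCSpace p
  exact ⟨inferInstance, inferInstance, inferInstance, inferInstance, inferInstance, inferInstance⟩

/-! ### Classification -/

/-- The classification of infinite second-countable locally compact spaces over `𝔽_p`. -/
theorem IsInfiniteLCSpace.nonempty_equiv {p : ℕ} [Fact p.Prime] {V : Type*} [AddCommGroup V]
    [Module (ZMod p) V] [TopologicalSpace V] (hV : IsInfiniteLCSpace p V) :
    Nonempty (V ≃L[ZMod p] VPlus p) ∨ Nonempty (V ≃L[ZMod p] VMinus p) ∨
      Nonempty (V ≃L[ZMod p] VSum p) := by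
  obtain ⟨_, _, _, _, _, _⟩ := hV
  by_cases hd : DiscreteTopology V
  · have : Countable V := TopologicalSpace.separableSpace_iff_countable.1 inferInstance
    exact Or.inl nonempty_equiv_vPlus
  by_cases hc : CompactSpace V
  · exact Or.inr (Or.inl nonempty_equiv_vMinus)
  refine Or.inr (Or.inr ?_)
  obtain ⟨W, hWo, hWc⟩ := exists_isOpen_isCompact_submodule (p := p) (V := V)
  obtain ⟨C, e, heW, heC, -⟩ :=
    (Submodule.closedComplemented_of_isOpen hWo).exists_submodule_equiv_prod
  have : CompactSpace W := isCompact_iff_compactSpace.1 hWc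
  -- The open subspace `W` meets its complement `C` only in 0.
  have hCd : DiscreteTopology C := by
    rw [discreteTopology_iff_isOpen_singleton_zero]
    convert hWo.preimage (continuous_subtype_val : Continuous (Subtype.val : C → V)) using 1
    ext y
    simp only [Set.mem_singleton_iff, Set.mem_preimage, SetLike.mem_coe]
    constructor
    · rintro rfl
      exact W.zero_mem
    · intro hy
      have h := (heW ⟨y, hy⟩).symm.trans (heC y)
      exact (congrArg Prod.snd h).symm
  -- A finite `W` would make `V` discrete, and a finite `C` would make it compact.
  have : Infinite W := by
    by_contra hfin
    rw [not_infinite_iff_finite] at hfin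
    have : DiscreteTopology W := inferInstance
    exact hd (e.toHomeomorph.symm.discreteTopology)
  have : Infinite C := by
    by_contra hfin
    rw [not_infinite_iff_finite] at hfin
    exact hc e.toHomeomorph.symm.compactSpace
  have : Countable C := TopologicalSpace.separableSpace_iff_countable.1 inferInstance
  have : SecondCountableTopology W :=
    TopologicalSpace.Subtype.secondCountableTopology (W : Set V)
  obtain ⟨e₁⟩ := nonempty_equiv_vMinus (p := p) (V := W)
  obtain ⟨e₂⟩ := nonempty_equiv_vPlus (p := p) (V := C)
  exact ⟨e.trans (e₁.prodCongr e₂)⟩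

theorem mainTheorem9 (p : ℕ) [Fact p.Prime] :
    -- the three spaces belong to the class that is classified
    (IsInfiniteLCSpace p (VPlus p) ∧ IsInfiniteLCSpace p (VMinus p) ∧
      IsInfiniteLCSpace p (VSum p)) ∧
    -- no two of them are isomorphic
    (IsEmpty (VPlus p ≃L[ZMod p] VMinus p) ∧ IsEmpty (VPlus p ≃L[ZMod p] VSum p) ∧
      IsEmpty (VMinus p ≃L[ZMod p] VSum p)) ∧
    -- every space of the class is isomorphic to one of them
    (∀ (V : Type*) [AddCommGroup V] [Module (ZMod p) V] [TopologicalSpace V],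
      IsInfiniteLCSpace p V →
        Nonempty (V ≃L[ZMod p] VPlus p) ∨ Nonempty (V ≃L[ZMod p] VMinus p) ∨
          Nonempty (V ≃L[ZMod p] VSum p)) := by
  have := vPlus_discreteTopology p
  refine ⟨⟨vPlus_isInfiniteLCSpace p, vMinus_isInfiniteLCSpace p, vSum_isInfiniteLCSpace p⟩,
    ⟨⟨fun e => ?_⟩, ⟨fun e => ?_⟩, ⟨fun e => ?_⟩⟩, fun V _ _ _ hV => hV.nonempty_equiv⟩
  · exact vMinus_not_discreteTopology p e.toHomeomorph.discreteTopology
  · exact vSum_not_discreteTopology p e.toHomeomorph.discreteTopology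
  · exact vSum_not_compactSpace p e.toHomeomorph.compactSpace
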